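/- **Conventions.** A topological group $G$ is *periodic* if it is locally compact and totally disconnected and $\overline{\langle g\rangle}$ is compact for every $g\in G$. It is *inductively monothetic* if for every finite $F\subseteq G$ there is $g\in G$ with $\overline{\langle F\rangle}=\overline{\langle g\rangle}$. A locally compact group $G$ is *near abelian* with *base* $A$ if $A$ is a closed abelian subgroup, every closed subgroup of $A$ is normal in $G$, and $G/A$ is abelian and inductively monothetic; it is *$A$-nontrivial* if conjugation by the elements of $G$ induces more than two automorphisms of $A$. For a prime $p$, an element $g$ of a periodic group is a *$p$-element* if $\overline{\langle g\rangle}$ is a profinite $p$-group. Write $G_p$ for the set of all $p$-elements of $G$; for an abelian subgroup $B\le G$, write $B_p=B\cap G_p$, which is a subgroup. A periodic abelian group is *$\Pi$-procyclic* if each of its $p$-primary components is finite cyclic or isomorphic to $\mathbb Z_p$. If $a$ is a $q$-element and $z\in\mathbb Z_q$, then $a^z$ is the image of $z$ under the unique continuous homomorphism $\mathbb Z_q\to G$ with $1\mapsto a$. Put $[x,a]=xax^{-1}a^{-1}$. **Theorem (Structure Theorem IV on periodic near abelian groups).** Let $G$ be a periodic near abelian group with base $A$ such that $G$ is $A$-nontrivial,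 and let $H$ be a closed $\Pi$-procyclic subgroup with $G=A\,Z(G)\,H$. Let $p,q$ be primes such that $e_{pq}$ is an edge of the prime graph of $G$, that is, $[H_p,A_q]\ne\{1\}$. 1. If $p\neq q$ (the edge is sloping), then $q\ne 2$ and $p\mid q-1$. Moreover, - $(C_1)$ for every $x\in G_p\setminus C_G(A_q)$ the function $a\mapsto[x,a]$ is an automorphism of the topological group $A_q$; in particular $[x,A_q]=A_q$; - $(C_2)$ $A_q\cap Z(G)=\{1\}$. 2. If $p=q$ (the edge is vertical), then for every $x\in G_q\setminus C_G(A_q)$ there are a unit $s\in\mathbb Z_q^\times$ and an integer $m\ge 1$ such that $[x,a]=a^{q^m s}$ for all $a\in A_q$; consequently $\{[x,a]:a\in A_q\}=\{a^{q^m}:a\in A_q\}$, and the exponent of $A_q\cap Z(G)$ divides $q^m$. -/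

import Mathlib

open Filter Topology
open scoped commutatorElement

namespace NearAbelian

/-- A topological group is *periodic* if it is locally compact and totally disconnected and every
element lies in a compact subgroup, i.e. the closed subgroup generated by it is compact. -/
structure IsPeriodic (G : Type*) [Group G] [TopologicalSpace G] [IsTopologicalGroup G] : Prop where
  locallyCompact : LocallyCompactSpace G
  totallyDisconnected : TotallyDisconnectedSpace G
  isCompact_closure_zpowers :
    ∀ g : G, IsCompact ((Subgroup.zpowers g).topologicalClosure : Set G)

/-- A topological group is *inductively monothetic* if every closed subgroup that is topologically
generated by finitely many elements is topologically generated by a single element. -/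
def IsInductivelyMonothetic (G : Type*) [Group G] [TopologicalSpace G] [IsTopologicalGroup G] :
    Prop :=
  ∀ F : Finset G, ∃ g : G,
    (Subgroup.closure (F : Set G)).topologicalClosure = (Subgroup.zpowers g).topologicalClosure

/-- `A` is a *base* of the near abelian (locally compact) group `G`. The normality of `A`, needed
for the quotient group `G ⧸ A`, is a special case of `normal_of_isClosed`. -/
structure IsNearAbelianBase {G : Type*} [Group G] [TopologicalSpace G] [IsTopologicalGroup G]
    (A : Subgroup G) [A.Normal] : Prop where
  locallyCompact : LocallyCompactSpace G
  isClosed : IsClosed (A : Set G)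
  comm : ∀ a ∈ A, ∀ b ∈ A, a * b = b * a
  quotient_comm : ∀ x y : G ⧸ A, x * y = y * x
  quotient_inductivelyMonothetic : IsInductivelyMonothetic (G ⧸ A)
  normal_of_isClosed : ∀ B : Subgroup G, B ≤ A → IsClosed (B : Set G) → B.Normal

/-- `G` is `A`-*nontrivial*: conjugation induces more than two automorphisms on `A`. (For abelian
`A` the map `G → Aut A` factors through `ψ : G ⧸ A → Aut A`, which has the same image.) -/
def IsNontrivialOver {G : Type*} [Group G] (A : Subgroup G) [A.Normal] : Prop :=
  2 < (Set.range (MulAut.conjNormal : G →* MulAut A)).encard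

/-- A *profinite `p`-group*: compact, totally disconnected, and every open normal subgroup has
index a power of `p`. -/
structure IsProPGroup (p : ℕ) (M : Type*) [Group M] [TopologicalSpace M] : Prop where
  compactSpace : CompactSpace M
  totallyDisconnected : TotallyDisconnectedSpace M
  index_eq_pow : ∀ U : Subgroup M, U.Normal → IsOpen (U : Set M) → ∃ n : ℕ, U.index = p ^ n

/-- `g` is a `p`-*element*: the closed subgroup generated by `g` is a profinite `p`-group. -/
def IsPElement {G : Type*} [Group G] [TopologicalSpace G] [IsTopologicalGroup G] (p : ℕ) (g : G) :
    Prop :=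
  IsProPGroup p (Subgroup.zpowers g).topologicalClosure

/-- The `p`-primary component (`p`-Sylow subgroup) `A_p` of an abelian subgroup `A` of a periodic
group. It consists of the `p`-elements of `A`, see `mem_primaryComponent_iff`. -/
def primaryComponent {G : Type*} [Group G] [TopologicalSpace G] [IsTopologicalGroup G] (p : ℕ)
    (A : Subgroup G) : Subgroup G :=
  Subgroup.closure {g : G | g ∈ A ∧ IsPElement p g}

theorem IsPElement.tendsto {G : Type*} [Group G] [TopologicalSpace G] [IsTopologicalGroup G]
    {p : ℕ} {g : G} (hg : IsPElement p g) : Tendsto (fun n : ℕ => g ^ p ^ n) atTop (𝓝 1) := by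
  have := hg.compactSpace
  have := hg.totallyDisconnected
  let x : (Subgroup.zpowers g).topologicalClosure :=
    ⟨g, Subgroup.le_topologicalClosure _ (Subgroup.mem_zpowers g)⟩
  have key : Tendsto (fun n : ℕ => x ^ p ^ n) atTop (𝓝 1) := by
    intro O hO
    obtain ⟨O', hO', hopen, h1⟩ := mem_nhds_iff.mp hO
    obtain ⟨H, hH⟩ := ProfiniteGrp.exist_openNormalSubgroup_sub_open_nhds_of_one hopen h1
    obtain ⟨k, hk⟩ := hg.index_eq_pow H.toSubgroup inferInstance H.isOpen'
    refine mem_map.mpr (mem_atTop_sets.mpr ⟨k, fun n hn => hO' (hH ?_)⟩)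
    obtain ⟨c, hc⟩ := pow_dvd_pow p hn
    have h2 : x ^ p ^ k ∈ H.toSubgroup := by
      rw [← hk]; exact H.toSubgroup.pow_index_mem x
    change x ^ p ^ n ∈ H.toSubgroup
    rw [hc, pow_mul]
    exact H.toSubgroup.pow_mem h2 c
  have := (continuous_subtype_val.tendsto _).comp key
  simpa [x, Function.comp_def] using this

theorem IsPeriodic.isPElement_of_tendsto {G : Type*} [Group G] [TopologicalSpace G]
    [IsTopologicalGroup G] (hG : IsPeriodic G) {p : ℕ} [Fact p.Prime] {g : G}
    (hg : Tendsto (fun n : ℕ => g ^ p ^ n) atTop (𝓝 1)) : IsPElement p g := by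
  have := hG.totallyDisconnected
  have hc : CompactSpace (Subgroup.zpowers g).topologicalClosure :=
    isCompact_iff_compactSpace.mp (hG.isCompact_closure_zpowers g)
  refine ⟨hc, inferInstance, fun U hU hUo => ?_⟩
  have hfin : Finite (_ ⧸ U) := U.quotient_finite_of_isOpen hUo
  obtain ⟨O, hO, hOU⟩ := isOpen_induced_iff.mp hUo
  have h1 : (1 : G) ∈ O := by
    have : (1 : (Subgroup.zpowers g).topologicalClosure) ∈ Subtype.val ⁻¹' O := by
      rw [hOU]; exact U.one_mem
    simpa using this
  obtain ⟨k, hk⟩ := (hg.eventually (hO.mem_nhds h1)).exists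
  let x : (Subgroup.zpowers g).topologicalClosure :=
    ⟨g, Subgroup.le_topologicalClosure _ (Subgroup.mem_zpowers g)⟩
  have hx : x ^ p ^ k ∈ U := by
    have : x ^ p ^ k ∈ Subtype.val ⁻¹' O := hk
    rw [hOU] at this; exact this
  have hcl : IsClosed {m : (Subgroup.zpowers g).topologicalClosure | m ^ p ^ k ∈ U} :=
    (U.isClosed_of_isOpen hUo).preimage (continuous_pow _)
  have hall : ∀ m : (Subgroup.zpowers g).topologicalClosure, m ^ p ^ k ∈ U := by
    have hd : Dense (Subtype.val ⁻¹' (Subgroup.zpowers g : Set G) :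
        Set (Subgroup.zpowers g).topologicalClosure) := by
      rw [Subtype.dense_iff]
      intro y hy
      refine closure_mono ?_ hy
      intro z hz
      exact ⟨⟨z, Subgroup.le_topologicalClosure _ hz⟩, hz, rfl⟩
    intro m
    refine hd.induction (P := fun m => m ^ p ^ k ∈ U) ?_ hcl m
    rintro y ⟨n, hn⟩
    have : y = x ^ n := by ext; simpa [x] using hn.symm
    rw [this, ← zpow_natCast, ← zpow_mul, mul_comm, zpow_mul, zpow_natCast]
    exact U.zpow_mem hx n
  have hp : IsPGroup p (_ ⧸ U) := by
    intro y
    induction y using QuotientGroup.induction_on with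
    | H m => exact ⟨k, by
        rw [← QuotientGroup.mk_pow]; exact (QuotientGroup.eq_one_iff _).mpr (hall m)⟩
  exact IsPGroup.iff_card.mp hp

theorem mem_primaryComponent_iff {G : Type*} [Group G] [TopologicalSpace G] [IsTopologicalGroup G]
    (hG : IsPeriodic G) (p : ℕ) [Fact p.Prime] {A : Subgroup G}
    (hA : ∀ a ∈ A, ∀ b ∈ A, a * b = b * a) {g : G} :
    g ∈ primaryComponent p A ↔ g ∈ A ∧ IsPElement p g := by
  refine ⟨fun h => ?_, fun h => Subgroup.subset_closure h⟩
  induction h using Subgroup.closure_induction with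
  | mem x hx => exact hx
  | one => exact ⟨A.one_mem, hG.isPElement_of_tendsto (by simp [tendsto_const_nhds])⟩
  | mul x y _ _ hx hy =>
    refine ⟨A.mul_mem hx.1 hy.1, hG.isPElement_of_tendsto ?_⟩
    have hxy : Commute x y := hA x hx.1 y hy.1
    simpa [hxy.mul_pow] using hx.2.tendsto.mul hy.2.tendsto
  | inv x _ hx =>
    exact ⟨A.inv_mem hx.1, hG.isPElement_of_tendsto (by simpa using hx.2.tendsto.inv)⟩

/-- A topological group is `Π`-*procyclic* if it is periodic and abelian and each of its `p`-Sylow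
subgroups is a finite cyclic group or isomorphic to the additive group `ℤ_p`. -/
structure IsPiProcyclic (H : Type*) [Group H] [TopologicalSpace H] [IsTopologicalGroup H] :
    Prop where
  periodic : IsPeriodic H
  comm : ∀ x y : H, x * y = y * x
  sylow : ∀ (p : ℕ) [Fact p.Prime],
    (Finite (primaryComponent p (⊤ : Subgroup H)) ∧
      IsCyclic (primaryComponent p (⊤ : Subgroup H))) ∨
    Nonempty (primaryComponent p (⊤ : Subgroup H) ≃ₜ* Multiplicative ℤ_[p])

/-- `H` is a closed `Π`-procyclic subgroup of `G` with `G = A Z(G) H`. -/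
structure IsFactorization {G : Type*} [Group G] [TopologicalSpace G] [IsTopologicalGroup G]
    (A H : Subgroup G) : Prop where
  isClosed : IsClosed (H : Set G)
  piProcyclic : IsPiProcyclic H
  exists_eq_mul : ∀ g : G, ∃ a ∈ A, ∃ z ∈ Subgroup.center G, ∃ h ∈ H, g = a * z * h

/-- There is an edge `e_{pq}` from `p` to `q` in the prime graph of `G = A Z(G) H`:
`[H_p, A_q] ≠ {1}`. (That then `p = q` or `p ∣ q - 1` is not made part of the definition.) -/
def IsPrimeGraphEdge {G : Type*} [Group G] [TopologicalSpace G] [IsTopologicalGroup G]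
    (A H : Subgroup G) (p q : ℕ) : Prop :=
  ⁅primaryComponent p H, primaryComponent q A⁆ ≠ ⊥

/-- `b = a ^ z` for a `p`-adic integer `z`: the value at `z` of the (unique) continuous homomorphism
`ℤ_p → G` with `1 ↦ a`. -/
def IsPadicPow {G : Type*} [Group G] [TopologicalSpace G] (p : ℕ) [Fact p.Prime] (a : G)
    (z : ℤ_[p]) (b : G) : Prop :=
  ∃ φ : Multiplicative ℤ_[p] →ₜ* G,
    φ (Multiplicative.ofAdd 1) = a ∧ φ (Multiplicative.ofAdd z) = b

end NearAbelian

/-! Each element of `A_q` admits `q`-adic exponents, so `A_q` is a `ℤ_q`-module. Closed subgroups of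
`A` are normal, so conjugation by `x` sends `a` into the closure of `⟨a⟩`, which is `ℤ_q a`: every
vector is an eigenvector. Over a discrete valuation ring the eigenvalue of `a` also serves every `b`
with larger annihilator (`eigenvalue_of_annihilator_le`). Annihilators form a chain and `ℤ_q` is
compact, so one scalar `r` serves all of `A_q` (`exists_forall_eq_smul`), and `a ↦ [x,a]` is
multiplication by `r - 1`.

If `x` is a `p`-element, then `x ^ p ^ n → 1`, hence `r ^ p ^ n • b → b`. So `r` has `p`-power order
modulo `q`. For `p ≠ q`, a residue `1` would make `(r ^ p ^ n - 1) / (r - 1)` a unit and force `r`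
to act trivially; hence `r - 1` is a unit and `p ∣ q - 1` (`isUnit_sub_one_and_dvd`). For `p = q`,
Frobenius is trivial on the residue field, so `r ≡ 1` and `r - 1 = q ^ m s` with `m ≥ 1`
(`natCast_dvd_sub_one`). Central elements of `A_q` are killed by `r - 1`. -/

namespace NearAbelian

/-! ### Open subgroups as a neighbourhood basis (van Dantzig). -/

/-- In a locally compact totally disconnected group, the open subgroups form a neighbourhood basis
of the identity. -/
theorem nonarchimedeanGroup_of_locallyCompact {G : Type*} [Group G] [TopologicalSpace G]
    [IsTopologicalGroup G] [LocallyCompactSpace G] [TotallyDisconnectedSpace G] :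
    NonarchimedeanGroup G where
  is_nonarchimedean U hU := by
    obtain ⟨C, hC, hC1, hCU⟩ := exists_compact_subset isOpen_interior (mem_interior_iff_mem_nhds.mpr hU)
    obtain ⟨K, hK, h1, hKC⟩ :=
      loc_compact_Haus_tot_disc_of_zero_dim.mem_nhds_iff.mp (mem_interior_iff_mem_nhds.mp hC1)
    have hKclopen : IsClopen K := hK
    have hKc : IsCompact K := hC.of_isClosed_subset hKclopen.1 hKC
    -- Since `K * V ⊆ K` and `1 ∈ K`, words in `V ∩ V⁻¹` never leave `K`.
    obtain ⟨V, hV, hKV⟩ := compact_open_separated_mul_right hKc hKclopen.2 subset_rfl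
    have hsub : ∀ x ∈ Subgroup.closure (V ∩ V⁻¹), x ∈ K := by
      intro x hx
      induction hx using Subgroup.closure_induction_right with
      | one => exact h1
      | mul_right x y _ hy hx => exact hKV (Set.mul_mem_mul hx hy.1)
      | mul_inv_cancel x y _ hy hx => exact hKV (Set.mul_mem_mul hx hy.2)
    refine ⟨⟨Subgroup.closure (V ∩ V⁻¹), Subgroup.isOpen_of_mem_nhds _ (g := 1) ?_⟩, fun x hx =>
      interior_subset (hCU (hKC (hsub x hx)))⟩
    exact mem_of_superset (inter_mem hV (inv_mem_nhds_one _ hV)) Subgroup.subset_closure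

/-! ### Eigenvalues over a discrete valuation ring. -/

section DiscreteValuationRing

variable {R M : Type*} [CommRing R] [IsDomain R] [IsDiscreteValuationRing R] [AddCommGroup M]
  [Module R M]

/-- For a linear map over a discrete valuation ring for which every vector is an eigenvector, the
eigenvalue of a vector also serves for all vectors with larger annihilator. -/
theorem eigenvalue_of_annihilator_le (f : M →ₗ[R] M) (hf : ∀ m, ∃ r : R, f m = r • m) {a b : M}
    (hab : ∀ y : R, y • a = 0 → y • b = 0) {r : R} (hr : f a = r • a) : f b = r • b := by
  -- it suffices to find a complement of `R a` in `R a + R b`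
  have compl : ∀ l : R, (∀ y z : R, y • (b - l • a) = z • a → y • (b - l • a) = 0) →
      f b = r • b := by
    intro l hl
    set c := b - l • a with hc
    obtain ⟨s, hs⟩ := hf c
    obtain ⟨t, ht⟩ := hf (a + c)
    have h1 : (s - t) • c = (t - r) • a := by
      rw [map_add, hr, hs] at ht
      linear_combination (norm := module) ht
    have h2 := hl _ _ h1
    rw [h2] at h1
    have h3 := hab _ h1.symm
    have h4 : (t - r) • c = 0 := by
      rw [hc, smul_sub, h3, smul_comm, ← h1]; simp
    have hfc : f c = r • c := by
      rw [hs]; linear_combination (norm := module) h2 + h4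
    have hb : b = c + l • a := by rw [hc]; abel
    rw [hb, map_add, map_smul, hfc, hr, smul_add, smul_comm]
  -- `d` generates the ideal of all `y` with `y • b ∈ R a`, and `d • b = e • a`. A complement exists
  -- if `e • a = 0` (take `l = 0`) or if `d ∣ e` (take `l = e / d`).
  let I : Ideal R := (Submodule.span R {a}).comap (LinearMap.toSpanSingleton R M b)
  have hI : ∀ y : R, y ∈ I ↔ ∃ z : R, z • a = y • b := fun y => by
    simp [I, Submodule.mem_span_singleton]
  obtain ⟨d, hd⟩ := (IsPrincipalIdealRing.principal I).principal
  have hdI : ∀ y : R, y ∈ I ↔ d ∣ y := fun y => by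
    rw [hd]; exact Ideal.mem_span_singleton
  obtain ⟨e, he⟩ := (hI d).1 ((hdI d).2 dvd_rfl)
  by_cases hea : e • a = 0
  · refine compl 0 fun y z hyz => ?_
    simp only [zero_smul, sub_zero] at hyz ⊢
    obtain ⟨w, rfl⟩ := (hdI y).1 ((hI y).2 ⟨z, hyz.symm⟩)
    rw [mul_comm, mul_smul, ← he, hea, smul_zero]
  by_cases hde : d ∣ e
  · obtain ⟨l, rfl⟩ := hde
    have hdc : d • (b - l • a) = 0 := by
      rw [smul_sub, ← he, mul_smul, sub_self]
    refine compl l fun y z hyz => ?_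
    obtain ⟨w, rfl⟩ := (hdI y).1 ((hI y).2 ⟨z + y * l, by
      rw [add_smul, ← hyz, smul_sub, mul_smul]; abel⟩)
    rw [mul_comm, mul_smul, hdc, smul_zero]
  obtain ⟨g, hg⟩ := (ValuationRing.dvd_total e d).resolve_right hde
  subst hg
  obtain ⟨π, hπ⟩ := IsDiscreteValuationRing.exists_irreducible R
  have hπdvd : ∀ x : R, ¬ IsUnit x → π ∣ x := fun x hx => by
    have : x ∈ IsLocalRing.maximalIdeal R := hx
    rwa [hπ.maximalIdeal_eq, Ideal.mem_span_singleton] at this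
  have hgu : ¬ IsUnit g := fun h => hde ((h.mul_right_dvd).2 dvd_rfl)
  obtain ⟨g', rfl⟩ := hπdvd g hgu
  -- Now `d = e * (π * g')`. If `b` is torsion with annihilator `(k)`, then `k = e * π * h'`, and `e
  -- * h'` kills `a`, hence `b`, although `k` does not divide it.
  by_cases htors : ∃ y : R, y ≠ 0 ∧ y • b = 0
  · exfalso
    let J : Ideal R := LinearMap.ker (LinearMap.toSpanSingleton R M b)
    have hJ : ∀ y : R, y ∈ J ↔ y • b = 0 := fun y => by simp [J]
    obtain ⟨k, hk⟩ := (IsPrincipalIdealRing.principal J).principal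
    have hkJ : ∀ y : R, y • b = 0 ↔ k ∣ y := fun y => by
      rw [← hJ, hk]; exact Ideal.mem_span_singleton
    have hk0 : k ≠ 0 := by
      rintro rfl
      obtain ⟨y, hy, hyb⟩ := htors
      exact hy (zero_dvd_iff.1 ((hkJ y).1 hyb))
    rcases ValuationRing.dvd_total k e with h | ⟨h, rfl⟩
    · exact hea (by rw [he, mul_comm, mul_smul, (hkJ e).2 h, smul_zero])
    · have hhu : ¬ IsUnit h := by
        intro hh
        refine hea ?_
        rw [he, (hkJ _).2 ((hh.mul_right_dvd).2 (Dvd.intro _ rfl))]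
      obtain ⟨h', rfl⟩ := hπdvd h hhu
      have h1 : (e * h') • a = 0 := by
        rw [mul_comm, mul_smul, he, ← mul_smul, (hkJ _).2 ⟨g', by ring⟩]
      obtain ⟨w, hw⟩ := (hkJ _).1 (hab _ h1)
      have h0 : e * h' ≠ 0 := fun h => hk0 (by linear_combination π * h)
      have : π * w = 1 := mul_left_cancel₀ h0 (by linear_combination -hw)
      exact hπ.not_isUnit (IsUnit.of_mul_eq_one _ this)
  -- For `b` torsion-free, applying `f` to `d • b = e • a` shows that the two eigenvalues coincide.
  · push Not at htors
    obtain ⟨s, hs⟩ := hf b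
    have h1 : ((r - s) * (e * (π * g'))) • b = 0 := by
      have h2 := congrArg f he
      rw [map_smul, map_smul, hr, hs, smul_comm, he] at h2
      rw [mul_smul, sub_smul, h2, smul_comm, sub_self]
    have h3 : (r - s) * (e * (π * g')) = 0 := by
      by_contra h; exact htors _ h h1
    have h4 : e * (π * g') ≠ 0 := fun h => hea (by rw [he, h, zero_smul])
    have h5 := (mul_eq_zero.1 h3).resolve_right h4
    rw [hs, sub_eq_zero.1 h5]

end DiscreteValuationRing

/-! ### Scalars on topological `ℤ_q`-modules. -/

section TopologicalModule

variable {q : ℕ} [Fact q.Prime] {B : Type*} [AddCommGroup B] [TopologicalSpace B] [Module ℤ_[q] B]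

/-- An endomorphism which maps each element to a multiple is multiplication by a scalar. -/
theorem exists_forall_eq_smul [T2Space B] (hc : ∀ b : B, Continuous fun z : ℤ_[q] => z • b)
    (f : B →ₗ[ℤ_[q]] B) (hf : ∀ b, ∃ r : ℤ_[q], f b = r • b) :
    ∃ r : ℤ_[q], ∀ b, f b = r • b := by
  let S : B → Set ℤ_[q] := fun b => {r | f b = r • b}
  have hcl : ∀ b, IsClosed (S b) := fun b => isClosed_eq continuous_const (hc b)
  have hdir : Directed (· ⊇ ·) S := by
    intro a b
    let ann : B → Ideal ℤ_[q] := fun b => LinearMap.ker (LinearMap.toSpanSingleton ℤ_[q] B b)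
    rcases (ValuationRing.le_total_ideal (A := ℤ_[q])).total (ann a) (ann b) with h | h
    · exact ⟨a, subset_rfl, fun r hr => eigenvalue_of_annihilator_le f hf (fun y hy => by
        simpa [ann] using h (show y ∈ ann a by simpa [ann] using hy)) hr⟩
    · exact ⟨b, fun r hr => eigenvalue_of_annihilator_le f hf (fun y hy => by
        simpa [ann] using h (show y ∈ ann b by simpa [ann] using hy)) hr, subset_rfl⟩
  obtain ⟨r, hr⟩ := IsCompact.nonempty_iInter_of_directed_nonempty_isCompact_isClosed S hdir
    hf (fun b => (hcl b).isCompact) hcl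
  exact ⟨r, fun b => Set.mem_iInter.1 hr b⟩

theorem smul_mem_of_isClosed (hc : ∀ b : B, Continuous fun z : ℤ_[q] => z • b) {U : AddSubgroup B}
    (hU : IsClosed (U : Set B)) {b : B} (hb : b ∈ U) (z : ℤ_[q]) : z • b ∈ U := by
  refine PadicInt.denseRange_intCast.induction_on (p := fun z : ℤ_[q] => z • b ∈ U) z
    (hU.preimage (hc b)) fun k => ?_
  rw [Int.cast_smul_eq_zsmul]
  exact U.zsmul_mem hb k

variable [NonarchimedeanAddGroup B]

/-- Open subgroups are closed, hence stable under `ℤ_q`; since they form a basis at zero, this gives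
continuity there. -/
theorem continuous_const_smul_padic (hc : ∀ b : B, Continuous fun z : ℤ_[q] => z • b)
    (z : ℤ_[q]) : Continuous fun b : B => z • b := by
  refine continuous_of_continuousAt_zero (DistribSMul.toAddMonoidHom B z) ?_
  intro V hV
  rw [map_zero] at hV
  obtain ⟨U, hU⟩ := NonarchimedeanAddGroup.is_nonarchimedean V hV
  rw [mem_map]
  exact mem_of_superset (U.isOpen.mem_nhds U.zero_mem) fun b hb =>
    hU (smul_mem_of_isClosed (U := U.toAddSubgroup) hc U.isClosed hb z)

theorem tendsto_sub_one_smul {p : ℕ} {r : ℤ_[q]} {b : B}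
    (hr : Tendsto (fun n : ℕ => r ^ p ^ n • b) atTop (𝓝 b)) :
    Tendsto (fun n : ℕ => (r ^ p ^ n - 1) • b) atTop (𝓝 0) := by
  simpa [sub_smul] using hr.sub_const b

variable [T2Space B]

theorem eq_zero_of_forall_mem_openAddSubgroup {b : B} (h : ∀ U : OpenAddSubgroup B, b ∈ U) :
    b = 0 := by
  by_contra hb
  obtain ⟨U, hU⟩ := NonarchimedeanAddGroup.is_nonarchimedean _
    (isOpen_compl_singleton.mem_nhds (Ne.symm hb : (0 : B) ∈ ({b}ᶜ : Set B)))
  exact hU (h U) rfl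

/-- If `w n • b` tends to zero, where the `w n` all divide `z`, then `z • b = 0`. -/
theorem smul_eq_zero_of_tendsto (hc : ∀ b : B, Continuous fun z : ℤ_[q] => z • b) {b : B}
    {w : ℕ → ℤ_[q]} (hw : Tendsto (fun n => w n • b) atTop (𝓝 0)) {z : ℤ_[q]}
    (hz : ∀ n, w n ∣ z) : z • b = 0 := by
  refine eq_zero_of_forall_mem_openAddSubgroup fun U => ?_
  obtain ⟨n, hn⟩ := (hw.eventually (U.isOpen.mem_nhds U.zero_mem)).exists
  obtain ⟨v, hv⟩ := hz n
  rw [hv, mul_comm, mul_smul]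
  exact smul_mem_of_isClosed (U := U.toAddSubgroup) hc U.isClosed hn v

/-- A scalar whose `p`-power powers converge to the identity has a `p`-power residue order. -/
theorem exists_toZMod_pow_eq_one (hc : ∀ b : B, Continuous fun z : ℤ_[q] => z • b) {p : ℕ}
    {r : ℤ_[q]} {b : B} (hb : b ≠ 0) (hr : Tendsto (fun n : ℕ => r ^ p ^ n • b) atTop (𝓝 b)) :
    ∃ n : ℕ, PadicInt.toZMod r ^ p ^ n = 1 := by
  by_contra! h
  refine hb ?_
  rw [← one_smul ℤ_[q] b]
  -- If no residue power is `1`, every `r ^ p ^ n - 1` is a unit, so it divides `1` and `1 • b = 0`.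
  refine smul_eq_zero_of_tendsto hc (tendsto_sub_one_smul hr) fun n => IsUnit.dvd ?_
  by_contra hu
  have : r ^ p ^ n - 1 ∈ RingHom.ker (PadicInt.toZMod (p := q)) := by
    rw [PadicInt.ker_toZMod]; exact hu
  rw [RingHom.mem_ker, map_sub, map_pow, map_one, sub_eq_zero] at this
  exact h n this

/-- The residue of `r` has `p`-power order, and this order is not `1`: otherwise the geometric sum
with `p ^ n` terms reduces to `p ^ n ≠ 0` modulo `q`, so `r - 1` is divisible by every `r ^ p ^ n -
1` and kills `b`. A nontrivial `p`-power order dividing `q - 1` gives the divisibility. -/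
theorem isUnit_sub_one_and_dvd (hc : ∀ b : B, Continuous fun z : ℤ_[q] => z • b) {p : ℕ}
    [Fact p.Prime] (hpq : p ≠ q) {r : ℤ_[q]} {b : B} (hrb : r • b ≠ b)
    (hr : Tendsto (fun n : ℕ => r ^ p ^ n • b) atTop (𝓝 b)) : IsUnit (r - 1) ∧ p ∣ q - 1 := by
  have hb : b ≠ 0 := by rintro rfl; simp at hrb
  obtain ⟨n, hn⟩ := exists_toZMod_pow_eq_one hc hb hr
  have hr1 : PadicInt.toZMod r ≠ 1 := by
    intro h1
    refine hrb (sub_eq_zero.1 ?_)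
    have : (r - 1) • b = 0 := by
      refine smul_eq_zero_of_tendsto hc (tendsto_sub_one_smul hr) fun n => ?_
      have hu : IsUnit (∑ i ∈ Finset.range (p ^ n), r ^ i) := by
        by_contra hu
        have : ∑ i ∈ Finset.range (p ^ n), r ^ i ∈ RingHom.ker (PadicInt.toZMod (p := q)) := by
          rw [PadicInt.ker_toZMod]; exact hu
        rw [RingHom.mem_ker, map_sum] at this
        simp only [map_pow, h1, one_pow, Finset.sum_const, Finset.card_range, nsmul_eq_mul,
          mul_one, Nat.cast_pow] at this
        have h2 := (ZMod.natCast_eq_zero_iff p q).1 (eq_zero_of_pow_eq_zero this)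
        exact hpq ((Nat.prime_dvd_prime_iff_eq Fact.out Fact.out).1 h2).symm
      rw [← geom_sum_mul]
      exact (hu.mul_left_dvd).2 dvd_rfl
    simpa [sub_smul] using this
  refine ⟨?_, ?_⟩
  · by_contra hu
    have : r - 1 ∈ RingHom.ker (PadicInt.toZMod (p := q)) := by
      rw [PadicInt.ker_toZMod]; exact hu
    rw [RingHom.mem_ker, map_sub, map_one, sub_eq_zero] at this
    exact hr1 this
  · obtain ⟨k, -, hk⟩ := (Nat.dvd_prime_pow Fact.out).1 (orderOf_dvd_of_pow_eq_one hn)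
    have hk0 : k ≠ 0 := by
      rintro rfl
      exact hr1 (orderOf_eq_one_iff.1 (by simpa using hk))
    have h0 : PadicInt.toZMod r ≠ 0 := by
      intro h; rw [h, zero_pow (pow_ne_zero _ (Fact.out : p.Prime).ne_zero)] at hn
      exact zero_ne_one hn
    exact (dvd_pow_self p hk0).trans (hk ▸ ZMod.orderOf_dvd_card_sub_one h0)

/-- The `q`-power map is the identity on `ZMod q`, so a residue of `q`-power order is already `1`.
-/
theorem natCast_dvd_sub_one (hc : ∀ b : B, Continuous fun z : ℤ_[q] => z • b)
    {r : ℤ_[q]} {b : B} (hb : b ≠ 0) (hr : Tendsto (fun n : ℕ => r ^ q ^ n • b) atTop (𝓝 b)) :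
    (q : ℤ_[q]) ∣ r - 1 := by
  obtain ⟨n, hn⟩ := exists_toZMod_pow_eq_one hc hb hr
  rw [ZMod.pow_card_pow] at hn
  rw [← Ideal.mem_span_singleton, ← PadicInt.maximalIdeal_eq_span_p, ← PadicInt.ker_toZMod,
    RingHom.mem_ker, map_sub, hn, map_one, sub_self]

end TopologicalModule

/-! ### Powers with `q`-adic exponents. -/

section PadicPow

variable {q : ℕ} {G : Type*} [Group G] [TopologicalSpace G]

theorem exists_forall_zpow_mem [IsTopologicalGroup G] {a : G}
    (ha : Tendsto (fun n : ℕ => a ^ q ^ n) atTop (𝓝 1)) (U : OpenSubgroup G) :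
    ∃ n : ℕ, ∀ k : ℤ, (q ^ n : ℤ) ∣ k → a ^ k ∈ U := by
  obtain ⟨n, hn⟩ := (ha.eventually (U.isOpen.mem_nhds U.one_mem)).exists
  refine ⟨n, ?_⟩
  rintro _ ⟨l, rfl⟩
  rw [zpow_mul]
  refine U.toSubgroup.zpow_mem ?_ l
  exact_mod_cast hn

variable [Fact q.Prime]

theorem comap_intCast_nhds_neBot (z : ℤ_[q]) :
    (comap (Int.cast : ℤ → ℤ_[q]) (𝓝 z)).NeBot :=
  comap_neBot_iff_frequently.2 (mem_closure_iff_frequently.1 (PadicInt.denseRange_intCast z))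

theorem setOf_norm_sub_le_mem_nhds (z : ℤ_[q]) (n : ℕ) :
    {y : ℤ_[q] | ‖y - z‖ ≤ (q : ℝ) ^ (-n : ℤ)} ∈ 𝓝 z := by
  have : (0 : ℝ) < (q : ℝ) ^ (-n : ℤ) :=
    zpow_pos (by exact_mod_cast (Fact.out : q.Prime).pos) _
  refine mem_of_superset (Metric.ball_mem_nhds z this) fun y hy => ?_
  rw [Metric.mem_ball, dist_eq_norm] at hy
  exact hy.le

/-- The value at a `q`-adic integer `z` of the extension of `k ↦ a ^ k` exists as a limit. -/
theorem exists_tendsto_zpow [NonarchimedeanGroup G] {a : G}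
    (hc : IsCompact ((Subgroup.zpowers a).topologicalClosure : Set G))
    (ha : Tendsto (fun n : ℕ => a ^ q ^ n) atTop (𝓝 1)) (z : ℤ_[q]) :
    ∃ y : G, Tendsto (fun k : ℤ => a ^ k) (comap Int.cast (𝓝 z)) (𝓝 y) := by
  have := comap_intCast_nhds_neBot z
  -- Compactness gives a limit `y` along an ultrafilter. Integers close to `z` differ by multiples
  -- of `q ^ n`, so their powers of `a` differ by elements of `U`, and the whole filter converges to
  -- `y`.
  let F := Ultrafilter.of (comap (Int.cast : ℤ → ℤ_[q]) (𝓝 z))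
  have hF : (F : Filter ℤ) ≤ comap Int.cast (𝓝 z) := Ultrafilter.of_le _
  obtain ⟨y, -, hy⟩ := hc.ultrafilter_le_nhds (F.map fun k : ℤ => a ^ k) (by
    rw [le_principal_iff]
    exact mem_map.2 (univ_mem' fun k => Subgroup.le_topologicalClosure _
      (Subgroup.zpow_mem_zpowers a k)))
  refine ⟨y, fun V hV => ?_⟩
  have hV' : (fun u => y * u) ⁻¹' V ∈ 𝓝 (1 : G) :=
    (continuous_const_mul y).continuousAt.preimage_mem_nhds (by simpa using hV)
  obtain ⟨U, hU⟩ := NonarchimedeanGroup.is_nonarchimedean _ hV'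
  obtain ⟨n, hn⟩ := exists_forall_zpow_mem ha U
  have h1 : ∀ᶠ k : ℤ in comap Int.cast (𝓝 z), ‖(k : ℤ_[q]) - z‖ ≤ (q : ℝ) ^ (-n : ℤ) :=
    preimage_mem_comap (setOf_norm_sub_le_mem_nhds z n)
  have h2 : ∀ᶠ k in (F : Filter ℤ), y⁻¹ * a ^ k ∈ U := by
    refine hy (show {x | y⁻¹ * x ∈ U} ∈ 𝓝 y from ?_)
    refine (continuous_const_mul y⁻¹).continuousAt.preimage_mem_nhds ?_
    exact U.isOpen.mem_nhds (by simp)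
  obtain ⟨k₀, hk₀, hk₀'⟩ := (h2.and (hF h1)).exists
  refine mem_map.2 (mem_of_superset h1 fun k hk => ?_)
  have hdvd : (q ^ n : ℤ) ∣ k - k₀ := by
    have h : ‖((k - k₀ : ℤ) : ℤ_[q])‖ ≤ (q : ℝ) ^ (-n : ℤ) := by
      have : ((k - k₀ : ℤ) : ℤ_[q]) = (k - z) + -(k₀ - z) := by push_cast; ring
      rw [this]
      exact (PadicInt.nonarchimedean _ _).trans (max_le hk (by rwa [norm_neg]))
    exact_mod_cast (PadicInt.norm_int_le_pow_iff_dvd).1 h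
  have : y⁻¹ * a ^ k ∈ U := by
    have h := U.mul_mem hk₀ (hn _ hdvd)
    rwa [mul_assoc, ← zpow_add, add_sub_cancel] at h
  simpa using hU this

/-- An element `a` of a compact monothetic group with `a ^ q ^ n → 1` has powers with `q`-adic
exponents. -/
theorem exists_padicHom [NonarchimedeanGroup G] [T2Space G] {a : G}
    (hc : IsCompact ((Subgroup.zpowers a).topologicalClosure : Set G))
    (ha : Tendsto (fun n : ℕ => a ^ q ^ n) atTop (𝓝 1)) :
    ∃ φ : Multiplicative ℤ_[q] →ₜ* G, φ (Multiplicative.ofAdd 1) = a := by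
  choose f hf using exists_tendsto_zpow hc ha
  have hint : ∀ k : ℤ, f k = a ^ k := fun k =>
    tendsto_nhds_unique ((hf k).mono_left (map_le_iff_le_comap.1 (by
      rw [map_pure]; exact pure_le_nhds _))) (tendsto_pure_nhds (fun k : ℤ => a ^ k) k)
  have hadd : ∀ z w, f (z + w) = f z * f w := fun z w => by
    have h1 : Tendsto (fun k : ℤ × ℤ => k.1 + k.2)
        (comap Int.cast (𝓝 z) ×ˢ comap Int.cast (𝓝 w)) (comap Int.cast (𝓝 (z + w))) := by
      rw [tendsto_comap_iff]
      have := (tendsto_comap.prodMap tendsto_comap : Tendsto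
        (Prod.map (Int.cast : ℤ → ℤ_[q]) (Int.cast : ℤ → ℤ_[q])) (comap _ (𝓝 z) ×ˢ comap _ (𝓝 w)) _)
      rw [← nhds_prod_eq] at this
      refine ((continuous_add.tendsto (z, w)).comp this).congr fun k => ?_
      simp
    have h2 := (hf (z + w)).comp h1
    have h3 := (((hf z).comp tendsto_fst).mul ((hf w).comp tendsto_snd) : Tendsto _
      (comap Int.cast (𝓝 z) ×ˢ comap Int.cast (𝓝 w)) _)
    have := comap_intCast_nhds_neBot z
    have := comap_intCast_nhds_neBot w
    refine tendsto_nhds_unique (h2.congr fun k => ?_) h3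
    simp [zpow_add]
  have hcont : ContinuousAt f 0 := by
    intro V hV
    rw [← Int.cast_zero, hint, zpow_zero] at hV
    obtain ⟨U, hU⟩ := NonarchimedeanGroup.is_nonarchimedean V hV
    obtain ⟨n, hn⟩ := exists_forall_zpow_mem ha U
    refine mem_map.2 (mem_of_superset (setOf_norm_sub_le_mem_nhds 0 n) fun z hz => hU ?_)
    have hz' : ‖z‖ ≤ (q : ℝ) ^ (-n : ℤ) := by simpa using hz
    have := comap_intCast_nhds_neBot z
    -- `f z` is a limit of powers `a ^ k` with `q ^ n ∣ k`, all in `U`, and open subgroups are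
    -- closed.
    refine U.isClosed.mem_of_tendsto (hf z) ?_
    filter_upwards [preimage_mem_comap (setOf_norm_sub_le_mem_nhds z n)] with k hk
    refine hn k ?_
    have hk' : ‖(k : ℤ_[q]) - z‖ ≤ (q : ℝ) ^ (-n : ℤ) := hk
    have h : ‖(k : ℤ_[q])‖ ≤ (q : ℝ) ^ (-n : ℤ) := by
      rw [← sub_add_cancel (k : ℤ_[q]) z]
      exact (PadicInt.nonarchimedean _ _).trans (max_le hk' hz')
    exact_mod_cast (PadicInt.norm_int_le_pow_iff_dvd).1 h
  let φ : Multiplicative ℤ_[q] →* G := MonoidHom.mk' (fun z => f z.toAdd) fun z w => hadd _ _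
  refine ⟨⟨φ, continuous_of_continuousAt_one φ hcont⟩, ?_⟩
  have h1 : f 1 = a := by simpa using hint 1
  exact h1

/-- The integers are dense in `ℤ_[q]`. This uniqueness makes the chosen homomorphisms in
`padicModule` compatible with each other. -/
theorem padicHom_ext [T2Space G] {φ ψ : Multiplicative ℤ_[q] →ₜ* G}
    (h : φ (Multiplicative.ofAdd 1) = ψ (Multiplicative.ofAdd 1)) : φ = ψ := by
  ext z
  refine PadicInt.denseRange_intCast.induction_on
    (p := fun z : ℤ_[q] => φ (Multiplicative.ofAdd z) = ψ (Multiplicative.ofAdd z)) z.toAdd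
    (isClosed_eq (φ.continuous_toFun.comp continuous_ofAdd)
      (ψ.continuous_toFun.comp continuous_ofAdd)) fun k => ?_
  have : Multiplicative.ofAdd (k : ℤ_[q]) = Multiplicative.ofAdd (1 : ℤ_[q]) ^ k := by
    rw [← ofAdd_zsmul, zsmul_one]
  rw [this, map_zpow, map_zpow, h]

/-- Every value of a homomorphism from `ℤ_q` lies in the closed subgroup generated by the image of
one, and conversely. -/
theorem range_padicHom [IsTopologicalGroup G] [T2Space G] (φ : Multiplicative ℤ_[q] →ₜ* G) :
    Set.range φ = (Subgroup.zpowers (φ (Multiplicative.ofAdd 1))).topologicalClosure := by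
  have hint : ∀ k : ℤ, φ (Multiplicative.ofAdd (k : ℤ_[q])) = φ (Multiplicative.ofAdd 1) ^ k :=
    fun k => by
      rw [← map_zpow, ← ofAdd_zsmul, zsmul_one]
  apply subset_antisymm
  · rintro _ ⟨z, rfl⟩
    refine PadicInt.denseRange_intCast.induction_on
      (p := fun z : ℤ_[q] => φ (Multiplicative.ofAdd z) ∈
        ((Subgroup.zpowers (φ (Multiplicative.ofAdd 1))).topologicalClosure : Set G)) z.toAdd
      ((Subgroup.isClosed_topologicalClosure _).preimage
        (φ.continuous_toFun.comp continuous_ofAdd)) fun k => ?_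
    rw [hint]
    exact Subgroup.le_topologicalClosure _ (Subgroup.zpow_mem_zpowers _ k)
  · have : CompactSpace (Multiplicative ℤ_[q]) := inferInstanceAs (CompactSpace ℤ_[q])
    refine closure_minimal ?_ (isCompact_range φ.continuous_toFun).isClosed
    rintro _ ⟨k, rfl⟩
    exact ⟨_, hint k⟩

end PadicPow

/-! ### The `ℤ_q`-module structure. -/

section Module

variable (q : ℕ) [Fact q.Prime] {B : Type*} [CommGroup B] [TopologicalSpace B]
  [IsTopologicalGroup B] [T2Space B]

/-- An abelian group, all of whose elements have powers with `q`-adic exponents, is a module over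
the `q`-adic integers. -/
@[reducible]
noncomputable def padicModule
    (h : ∀ a : B, ∃ φ : Multiplicative ℤ_[q] →ₜ* B, φ (Multiplicative.ofAdd 1) = a) :
    Module ℤ_[q] (Additive B) where
  smul z a := Additive.ofMul ((h a.toMul).choose (Multiplicative.ofAdd z))
  one_smul a := (h a.toMul).choose_spec
  mul_smul z w a := by
    -- `m` is multiplication by `w`; as functions of `z`, both sides are continuous homomorphisms
    -- agreeing at `1`.
    let m : Multiplicative ℤ_[q] →ₜ* Multiplicative ℤ_[q] :=
      ⟨(AddMonoidHom.mulRight w).toMultiplicative, continuous_mul_const (M := ℤ_[q]) w⟩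
    refine congrArg Additive.ofMul (DFunLike.congr_fun (padicHom_ext (q := q)
      (φ := (h a.toMul).choose.comp m) (ψ := (h _).choose) ?_) (Multiplicative.ofAdd z))
    refine Eq.trans ?_ (h _).choose_spec.symm
    exact congrArg (h a.toMul).choose (congrArg Multiplicative.ofAdd (one_mul w))
  smul_zero z := by
    exact congrArg Additive.ofMul (DFunLike.congr_fun (padicHom_ext (q := q) (φ := (h 1).choose)
      (ψ := 1) (h 1).choose_spec) (Multiplicative.ofAdd z))
  smul_add z a b := by
    refine congrArg Additive.ofMul (DFunLike.congr_fun (padicHom_ext (q := q)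
      (φ := (h (a.toMul * b.toMul)).choose) (ψ := (h a.toMul).choose * (h b.toMul).choose) ?_)
        (Multiplicative.ofAdd z))
    refine (h _).choose_spec.trans ?_
    exact (congrArg₂ (· * ·) (h a.toMul).choose_spec (h b.toMul).choose_spec).symm
  add_smul z w a := congrArg Additive.ofMul
    (map_mul (h a.toMul).choose (Multiplicative.ofAdd z) (Multiplicative.ofAdd w))
  zero_smul a := congrArg Additive.ofMul (map_one (h a.toMul).choose)

/-- Frees the action from the choice in its definition: any homomorphism with the right value at `1`
computes it. -/
theorem padicModule_smul_eq
    (h : ∀ a : B, ∃ φ : Multiplicative ℤ_[q] →ₜ* B, φ (Multiplicative.ofAdd 1) = a)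
    (φ : Multiplicative ℤ_[q] →ₜ* B) (z : ℤ_[q]) :
    letI := padicModule q h
    z • Additive.ofMul (φ (Multiplicative.ofAdd 1)) = Additive.ofMul (φ (Multiplicative.ofAdd z)) :=
  congrArg Additive.ofMul (DFunLike.congr_fun (padicHom_ext (q := q)
    (φ := (h (φ (Multiplicative.ofAdd 1))).choose) (h _).choose_spec) (Multiplicative.ofAdd z))

theorem continuous_padicModule_smul
    (h : ∀ a : B, ∃ φ : Multiplicative ℤ_[q] →ₜ* B, φ (Multiplicative.ofAdd 1) = a)
    (a : Additive B) :
    letI := padicModule q h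
    Continuous fun z : ℤ_[q] => z • a :=
  (h a.toMul).choose.continuous_toFun

end Module

instance {B : Type*} [Group B] [TopologicalSpace B] [NonarchimedeanGroup B] :
    NonarchimedeanAddGroup (Additive B) where
  is_nonarchimedean U hU := by
    obtain ⟨V, hV⟩ := NonarchimedeanGroup.is_nonarchimedean (G := B) U hU
    exact ⟨⟨V.toSubgroup.toAddSubgroup, V.isOpen⟩, hV⟩

theorem nonarchimedeanGroup_subgroup {G : Type*} [Group G] [TopologicalSpace G]
    [NonarchimedeanGroup G] (S : Subgroup G) : NonarchimedeanGroup S where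
  is_nonarchimedean U hU := by
    obtain ⟨V, hV, hVU⟩ := mem_nhds_subtype (S : Set G) 1 U |>.1 hU
    obtain ⟨W, hW⟩ := NonarchimedeanGroup.is_nonarchimedean V hV
    exact ⟨W.comap S.subtype continuous_subtype_val, fun x hx => hVU (hW hx)⟩

instance {B : Type*} [TopologicalSpace B] [T2Space B] : T2Space (Additive B) :=
  inferInstanceAs (T2Space B)

/-! ### Endomorphisms preserving closed subgroups. -/

section PowerEndomorphism

variable (q : ℕ) [Fact q.Prime] {B : Type*} [CommGroup B] [TopologicalSpace B]

/-- A continuous endomorphism that leaves all closed subgroups invariant acts as a `q`-adic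
scalar. -/
theorem exists_scalar_of_mem_closure [IsTopologicalGroup B] [T2Space B]
    (h : ∀ a : B, ∃ φ : Multiplicative ℤ_[q] →ₜ* B, φ (Multiplicative.ofAdd 1) = a)
    (f : B →* B) (hf : Continuous f) (hmem : ∀ a, f a ∈ (Subgroup.zpowers a).topologicalClosure) :
    letI := padicModule q h
    ∃ r : ℤ_[q], ∀ a : Additive B, Additive.ofMul (f a.toMul) = r • a := by
  let := padicModule q h
  let F : Additive B →ₗ[ℤ_[q]] Additive B :=
    { toFun := fun a => Additive.ofMul (f a.toMul)
      map_add' := fun a b => congrArg Additive.ofMul (map_mul f a.toMul b.toMul)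
      map_smul' := fun z a => by
        obtain ⟨φ, hφ⟩ := h a.toMul
        have h1 := padicModule_smul_eq q h φ z
        have h2 := padicModule_smul_eq q h ((⟨f, hf⟩ : B →ₜ* B).comp φ) z
        rw [hφ] at h1
        rw [show ((⟨f, hf⟩ : B →ₜ* B).comp φ) (Multiplicative.ofAdd 1) = f a.toMul from
          congrArg f hφ] at h2
        exact (congrArg (fun b : Additive B => Additive.ofMul (f b.toMul)) h1).trans h2.symm }
  refine exists_forall_eq_smul (continuous_padicModule_smul q h) F fun a => ?_
  obtain ⟨φ, hφ⟩ := h a.toMul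
  have h1 := hmem a.toMul
  rw [← hφ, ← SetLike.mem_coe, ← range_padicHom] at h1
  obtain ⟨z, hz⟩ := h1
  have h2 := padicModule_smul_eq q h φ z.toAdd
  refine ⟨z.toAdd, ?_⟩
  rw [hφ] at h2 hz
  exact (congrArg Additive.ofMul hz).symm.trans h2.symm

variable [NonarchimedeanGroup B] [T2Space B]

theorem iterate_eq_pow_smul
    (h : ∀ a : B, ∃ φ : Multiplicative ℤ_[q] →ₜ* B, φ (Multiplicative.ofAdd 1) = a)
    (f : B →* B) {r : ℤ_[q]} :
    letI := padicModule q h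
    (∀ a : Additive B, Additive.ofMul (f a.toMul) = r • a) → ∀ (n : ℕ) (a : B),
      Additive.ofMul (f^[n] a) = r ^ n • Additive.ofMul a := by
  let := padicModule q h
  intro hr n
  induction n with
  | zero => intro a; simp
  | succ n ih =>
    intro a
    rw [Function.iterate_succ_apply, ih, pow_succ, mul_smul, ← hr]
    rfl

variable {q}

/-- A power automorphism whose `p`-power iterates tend to the identity, for `p ≠ q`, is fixed point
free unless it is trivial. -/
theorem exists_continuousMulEquiv_of_ne {p : ℕ} [Fact p.Prime] (hpq : p ≠ q)
    (h : ∀ a : B, ∃ φ : Multiplicative ℤ_[q] →ₜ* B, φ (Multiplicative.ofAdd 1) = a)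
    (f : B →* B) (hf : Continuous f) (hmem : ∀ a, f a ∈ (Subgroup.zpowers a).topologicalClosure)
    (hlim : ∀ a, Tendsto (fun n : ℕ => f^[p ^ n] a) atTop (𝓝 a)) (hne : ∃ a, f a ≠ a) :
    p ∣ q - 1 ∧ ∃ φ : B ≃ₜ* B, ∀ a, φ a = f a * a⁻¹ := by
  let := padicModule q h
  obtain ⟨r, hr⟩ := exists_scalar_of_mem_closure q h f hf hmem
  have hc := continuous_padicModule_smul q h
  obtain ⟨b, hb⟩ := hne
  have hlim' : Tendsto (fun n : ℕ => r ^ p ^ n • Additive.ofMul b) atTop (𝓝 (Additive.ofMul b)) := by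
    refine Tendsto.congr (fun n => iterate_eq_pow_smul q h f hr (p ^ n) b) ?_
    exact hlim b
  obtain ⟨⟨u, hu⟩, hdvd⟩ := isUnit_sub_one_and_dvd hc hpq (b := Additive.ofMul b)
    (fun h => hb (hr (Additive.ofMul b) |>.trans h)) hlim'
  refine ⟨hdvd, ?_⟩
  -- `u` is the unit `r - 1`; both `u` and `u⁻¹` act continuously.
  let φ : Additive B ≃+ Additive B := DistribMulAction.toAddEquiv (Additive B) u
  refine ⟨⟨φ.toMultiplicative, ?_, ?_⟩, fun a => ?_⟩
  · exact continuous_const_smul_padic hc (u : ℤ_[q])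
  · exact continuous_const_smul_padic hc ((u⁻¹ : ℤ_[q]ˣ) : ℤ_[q])
  · have h1 : (u : ℤ_[q]) • Additive.ofMul a = Additive.ofMul (f a) - Additive.ofMul a := by
      rw [hu, sub_smul, one_smul, ← hr]; rfl
    refine (show _ = _ from h1).trans ?_
    rw [← ofMul_div, div_eq_mul_inv]; rfl

/-- A nontrivial power automorphism whose `q`-power iterates tend to the identity is congruent to
one modulo `q`. -/
theorem exists_unit_pow_of_tendsto
    (h : ∀ a : B, ∃ φ : Multiplicative ℤ_[q] →ₜ* B, φ (Multiplicative.ofAdd 1) = a)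
    (f : B →* B) (hf : Continuous f) (hmem : ∀ a, f a ∈ (Subgroup.zpowers a).topologicalClosure)
    (hlim : ∀ a, Tendsto (fun n : ℕ => f^[q ^ n] a) atTop (𝓝 a)) (hne : ∃ a, f a ≠ a) :
    ∃ (s : ℤ_[q]ˣ) (m : ℕ), 1 ≤ m ∧
      (∀ a, IsPadicPow q a ((q : ℤ_[q]) ^ m * s) (f a * a⁻¹)) ∧
      (∀ a, ∃ b, f a * a⁻¹ = b ^ q ^ m) ∧ (∀ b, ∃ a, f a * a⁻¹ = b ^ q ^ m) ∧
      ∀ a, f a = a → a ^ q ^ m = 1 := by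
  let := padicModule q h
  obtain ⟨r, hr⟩ := exists_scalar_of_mem_closure q h f hf hmem
  have hc := continuous_padicModule_smul q h
  obtain ⟨b, hb⟩ := hne
  have hlim' : Tendsto (fun n : ℕ => r ^ q ^ n • Additive.ofMul b) atTop (𝓝 (Additive.ofMul b)) := by
    refine Tendsto.congr (fun n => iterate_eq_pow_smul q h f hr (q ^ n) b) ?_
    exact hlim b
  have hdvd := natCast_dvd_sub_one hc (b := Additive.ofMul b) (fun h => hb (by
    rw [show b = 1 from h, map_one])) hlim'
  have hr1 : r - 1 ≠ 0 := fun h => hb ((hr (Additive.ofMul b)).trans (by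
    rw [sub_eq_zero.1 h, one_smul]; rfl))
  have hspec := PadicInt.unitCoeff_spec hr1
  have hsub : ∀ a : B, Additive.ofMul (f a * a⁻¹) = (r - 1) • Additive.ofMul a := fun a => by
    rw [sub_smul, one_smul, ← hr, ← div_eq_mul_inv]; rfl
  -- `r - 1 = s * q ^ m`. The unit `s` only permutes the module, so the image and kernel of `r - 1`
  -- are those of `q ^ m`.
  set s := PadicInt.unitCoeff hr1
  set m := (r - 1).valuation
  have hpow : ∀ a : B, Additive.ofMul (a ^ q ^ m) = ((q : ℤ_[q]) ^ m) • Additive.ofMul a :=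
    fun a => by rw [ofMul_pow, ← Nat.cast_pow, Nat.cast_smul_eq_nsmul]
  refine ⟨s, m, ?_, fun a => ?_, fun a => ?_, fun a => ?_, fun a ha => ?_⟩
  · by_contra! hm
    rw [Nat.lt_one_iff.1 hm, pow_zero, mul_one] at hspec
    rw [hspec] at hdvd
    exact PadicInt.prime_p.not_isUnit (isUnit_of_dvd_unit hdvd s.isUnit)
  · obtain ⟨φ, hφ⟩ := h a
    refine ⟨φ, hφ, ?_⟩
    have h1 := padicModule_smul_eq q h φ ((q : ℤ_[q]) ^ m * s)
    rw [hφ, mul_comm _ (s : ℤ_[q]), ← hspec, ← hsub] at h1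
    rw [mul_comm, ← hspec]
    exact h1.symm
  · refine ⟨((s : ℤ_[q]) • Additive.ofMul a).toMul, Additive.ofMul.injective ?_⟩
    rw [hsub, hpow, hspec, mul_comm, mul_smul]; rfl
  · refine ⟨(((s⁻¹ : ℤ_[q]ˣ) : ℤ_[q]) • Additive.ofMul a).toMul, Additive.ofMul.injective ?_⟩
    rw [hsub, hpow, hspec, ofMul_toMul, smul_smul]
    congr 1
    rw [mul_comm, ← mul_assoc]; simp
  · have h1 := hsub a
    rw [ha, mul_inv_cancel, ofMul_one, hspec, mul_smul, ← hpow] at h1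
    have h2 := congrArg (fun c => ((s⁻¹ : ℤ_[q]ˣ) : ℤ_[q]) • c) h1
    simp only [smul_zero, smul_smul, Units.inv_mul, one_smul] at h2
    exact h2.symm

end PowerEndomorphism

theorem conjNormal_iterate {G : Type*} [Group G] (S : Subgroup G) [S.Normal] (x : G) (n : ℕ)
    (a : S) :
    (((MulAut.conjNormal x : MulAut S) : S →* S)^[n] a : G) = x ^ n * a * (x ^ n)⁻¹ := by
  induction n generalizing a with
  | zero => simp
  | succ n ih =>
    rw [Function.iterate_succ_apply, ih]
    simp [pow_succ, mul_assoc]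

/-! ### Conjugation on the primary components of the base. -/

section PrimaryComponent

variable {G : Type*} [Group G] [TopologicalSpace G] [IsTopologicalGroup G]

/-- Approximate `g` by a `q`-element `a` with `g⁻¹ * a ∈ U`. As `g` and `a` commute, `g ^ q ^ n`
differs from `a ^ q ^ n` by an element of `U`, so it eventually lies in `U`. -/
theorem isClosed_primaryComponent (hG : IsPeriodic G) (q : ℕ) [Fact q.Prime] {A : Subgroup G}
    (hAc : IsClosed (A : Set G)) (hA : ∀ a ∈ A, ∀ b ∈ A, a * b = b * a) :
    IsClosed (primaryComponent q A : Set G) := by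
  have := hG.locallyCompact
  have := hG.totallyDisconnected
  have : NonarchimedeanGroup G := nonarchimedeanGroup_of_locallyCompact
  refine isClosed_of_closure_subset fun g hg => ?_
  have hgA : g ∈ A := closure_minimal (fun a ha =>
    ((mem_primaryComponent_iff hG q hA).1 ha).1) hAc hg
  refine (mem_primaryComponent_iff hG q hA).2 ⟨hgA, hG.isPElement_of_tendsto ?_⟩
  refine tendsto_def.2 fun V hV => ?_
  obtain ⟨U, hU⟩ := NonarchimedeanGroup.is_nonarchimedean V hV
  have hnhds : {a : G | g⁻¹ * a ∈ U} ∈ 𝓝 g :=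
    (continuous_const_mul g⁻¹).continuousAt.preimage_mem_nhds (U.isOpen.mem_nhds (by simp))
  obtain ⟨a, hgU, ha⟩ := mem_closure_iff_nhds.1 hg _ hnhds
  obtain ⟨haA, haq⟩ := (mem_primaryComponent_iff hG q hA).1 ha
  filter_upwards [haq.tendsto.eventually (U.isOpen.mem_nhds U.one_mem)] with n hn
  refine hU ?_
  have hcomm : Commute g⁻¹ a := hA _ (A.inv_mem hgA) _ haA
  have h1 := U.toSubgroup.pow_mem hgU (q ^ n)
  rw [hcomm.mul_pow, inv_pow] at h1
  have h2 := U.toSubgroup.mul_mem hn (U.toSubgroup.inv_mem h1)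
  rwa [mul_inv_rev, inv_inv, mul_inv_cancel_left] at h2

theorem exists_padicHom_primaryComponent (hG : IsPeriodic G) (q : ℕ) [Fact q.Prime]
    {A : Subgroup G} (hAc : IsClosed (A : Set G)) (hA : ∀ a ∈ A, ∀ b ∈ A, a * b = b * a)
    (a : primaryComponent q A) :
    ∃ φ : Multiplicative ℤ_[q] →ₜ* primaryComponent q A, φ (Multiplicative.ofAdd 1) = a := by
  have := hG.locallyCompact
  have := hG.totallyDisconnected
  have : NonarchimedeanGroup G := nonarchimedeanGroup_of_locallyCompact
  obtain ⟨φ, hφ⟩ := exists_padicHom (q := q) (hG.isCompact_closure_zpowers (a : G))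
    ((mem_primaryComponent_iff hG q hA).1 a.2).2.tendsto
  have hmem : ∀ z, φ z ∈ primaryComponent q A := fun z => by
    have h1 : φ z ∈ Set.range φ := ⟨z, rfl⟩
    rw [range_padicHom, hφ] at h1
    exact Subgroup.topologicalClosure_minimal _ ((Subgroup.zpowers_le).2 a.2)
      (isClosed_primaryComponent hG q hAc hA) h1
  exact ⟨⟨φ.toMonoidHom.codRestrict _ hmem, φ.continuous_toFun.subtype_mk hmem⟩, Subtype.ext hφ⟩

theorem tendsto_conj_pow {p : ℕ} {x : G} (hx : IsPElement p x) (a : G) :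
    Tendsto (fun n : ℕ => x ^ p ^ n * a * (x ^ p ^ n)⁻¹) atTop (𝓝 a) := by
  simpa using (hx.tendsto.mul_const a).mul hx.tendsto.inv

variable {A : Subgroup G} [A.Normal]

/-- The facts on conjugation by a `p`-element on the `q`-component of the base. -/
theorem conj_primaryComponent (hG : IsPeriodic G) (hA : IsNearAbelianBase A) {p : ℕ} (q : ℕ)
    [Fact q.Prime] [(primaryComponent q A).Normal] {x : G} (hx : IsPElement p x)
    (hxc : x ∉ Subgroup.centralizer (primaryComponent q A : Set G)) :
    let f : primaryComponent q A →* primaryComponent q A :=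
      (MulAut.conjNormal x : MulAut (primaryComponent q A))
    Continuous f ∧ (∀ a, f a ∈ (Subgroup.zpowers a).topologicalClosure) ∧
      (∀ a, Tendsto (fun n : ℕ => f^[p ^ n] a) atTop (𝓝 a)) ∧ ∃ a, f a ≠ a := by
  intro f
  have hfa : ∀ a, (f a : G) = x * a * x⁻¹ := fun a => MulAut.conjNormal_apply x a
  refine ⟨?_, fun a => ?_, fun a => ?_, ?_⟩
  · refine Topology.IsInducing.subtypeVal.continuous_iff.2 ?_
    exact ((continuous_subtype_val.const_mul x).mul_const x⁻¹).congr fun a => (hfa a).symm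
  -- The closure of `⟨a⟩` is a closed subgroup of the base, hence normal, so it contains the
  -- conjugate of `a`.
  · have hle : (Subgroup.zpowers (a : G)).topologicalClosure ≤ A :=
      Subgroup.topologicalClosure_minimal _ ((Subgroup.zpowers_le).2
        ((mem_primaryComponent_iff hG q hA.comm).1 a.2).1) hA.isClosed
    have h1 := (hA.normal_of_isClosed _ hle (Subgroup.isClosed_topologicalClosure _)).conj_mem a
      (Subgroup.le_topologicalClosure _ (Subgroup.mem_zpowers _)) x
    have h2 : (f a : G) ∈ closure (Subgroup.zpowers (a : G) : Set G) := by rw [hfa]; exact h1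
    refine closure_subtype.2 (closure_mono ?_ h2)
    rintro _ ⟨k, rfl⟩
    exact ⟨a ^ k, ⟨k, rfl⟩, by simp⟩
  · refine tendsto_subtype_rng.2 ((tendsto_conj_pow hx (a : G)).congr fun n => ?_)
    exact (conjNormal_iterate _ x (p ^ n) a).symm
  · by_contra! hall
    refine hxc (Subgroup.mem_centralizer_iff.2 fun a ha => ?_)
    have h1 := hfa ⟨a, ha⟩
    rw [hall] at h1
    exact eq_mul_inv_iff_mul_eq.1 h1

end PrimaryComponent

/-- An edge of the prime graph gives a `p`-element that does not centralize `A_q`. -/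
theorem IsPrimeGraphEdge.exists_isPElement {G : Type*} [Group G] [TopologicalSpace G]
    [IsTopologicalGroup G] (hG : IsPeriodic G) {A H : Subgroup G} (hH : IsPiProcyclic H) {p q : ℕ}
    [Fact p.Prime] (hpq : IsPrimeGraphEdge A H p q) :
    ∃ x, IsPElement p x ∧ x ∉ Subgroup.centralizer (primaryComponent q A : Set G) := by
  by_contra! hall
  refine hpq (Subgroup.commutator_eq_bot_iff_le_centralizer.2 fun x hx => hall x ?_)
  exact ((mem_primaryComponent_iff hG p fun a ha b hb =>
    congrArg Subtype.val (hH.comm ⟨a, ha⟩ ⟨b, hb⟩)).1 hx).2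

end NearAbelian

/-! ### The structure theorem. -/

open NearAbelian in
theorem mainTheorem12 {G : Type*} [Group G] [TopologicalSpace G] [IsTopologicalGroup G]
    (hG : NearAbelian.IsPeriodic G)
    (A : Subgroup G) [A.Normal] (hA : NearAbelian.IsNearAbelianBase A)
    (hnt : NearAbelian.IsNontrivialOver A)
    (H : Subgroup G) (hH : NearAbelian.IsFactorization A H)
    (p q : ℕ) [Fact p.Prime] [Fact q.Prime] (hpq : NearAbelian.IsPrimeGraphEdge A H p q) :
    (p ≠ q →
      q ≠ 2 ∧ p ∣ q - 1 ∧
      (∀ x : G, NearAbelian.IsPElement p x →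
        x ∉ Subgroup.centralizer (NearAbelian.primaryComponent q A : Set G) →
        (∃ φ : NearAbelian.primaryComponent q A ≃ₜ* NearAbelian.primaryComponent q A,
          ∀ a : NearAbelian.primaryComponent q A, (φ a : G) = ⁅x, (a : G)⁆) ∧
        (fun a : G => ⁅x, a⁆) '' (NearAbelian.primaryComponent q A : Set G) =
          NearAbelian.primaryComponent q A) ∧
      NearAbelian.primaryComponent q A ⊓ Subgroup.center G = ⊥) ∧
    (p = q →
      ∀ x : G, NearAbelian.IsPElement q x →
        x ∉ Subgroup.centralizer (NearAbelian.primaryComponent q A : Set G) →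
        ∃ (s : ℤ_[q]ˣ) (m : ℕ), 1 ≤ m ∧
          (∀ a ∈ NearAbelian.primaryComponent q A,
            NearAbelian.IsPadicPow q a ((q : ℤ_[q]) ^ m * s) ⁅x, a⁆) ∧
          (fun a : G => ⁅x, a⁆) '' (NearAbelian.primaryComponent q A : Set G) =
            (fun a : G => a ^ q ^ m) '' (NearAbelian.primaryComponent q A : Set G) ∧
          Monoid.exponent
            (NearAbelian.primaryComponent q A ⊓ Subgroup.center G : Subgroup G) ∣ q ^ m) := by
  have := hG.locallyCompact
  have := hG.totallyDisconnected
  have : NonarchimedeanGroup G := nonarchimedeanGroup_of_locallyCompact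
  have hle : primaryComponent q A ≤ A := fun a ha =>
    ((mem_primaryComponent_iff hG q hA.comm).1 ha).1
  have hnormal : (primaryComponent q A).Normal := hA.normal_of_isClosed _ hle
    (isClosed_primaryComponent hG q hA.isClosed hA.comm)
  -- Built on the existing group structure, so that both multiplications agree definitionally.
  let : CommGroup (primaryComponent q A) :=
    { (inferInstance : Group (primaryComponent q A)) with
      mul_comm := fun a b => Subtype.ext (hA.comm a (hle a.2) b (hle b.2)) }
  have : NonarchimedeanGroup (primaryComponent q A) := nonarchimedeanGroup_subgroup _
  have hhom := exists_padicHom_primaryComponent hG q hA.isClosed hA.comm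
  have hconj : ∀ (x : G) (a : primaryComponent q A),
      ((MulAut.conjNormal x a * a⁻¹ : primaryComponent q A) : G) = ⁅x, (a : G)⁆ := fun x a => by
    simp [commutatorElement_def]
  have hcentral : ∀ (x : G) (a : primaryComponent q A), (a : G) ∈ Subgroup.center G →
      MulAut.conjNormal x a = a := fun x a ha => Subtype.ext (by
    rw [MulAut.conjNormal_apply, Subgroup.mem_center_iff.1 ha x, mul_inv_cancel_right])
  refine ⟨fun hne => ?_, ?_⟩
  · have key : ∀ x : G, IsPElement p x →
        x ∉ Subgroup.centralizer (primaryComponent q A : Set G) →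
        p ∣ q - 1 ∧ ∃ φ : primaryComponent q A ≃ₜ* primaryComponent q A,
          ∀ a : primaryComponent q A, (φ a : G) = ⁅x, (a : G)⁆ := fun x hx hxc => by
      obtain ⟨hf, hmem, hlim, hne'⟩ := conj_primaryComponent hG hA q hx hxc
      obtain ⟨hdvd, φ, hφ⟩ := exists_continuousMulEquiv_of_ne hne hhom _ hf hmem hlim hne'
      exact ⟨hdvd, φ, fun a => (congrArg Subtype.val (hφ a)).trans (hconj x a)⟩
    obtain ⟨x, hx, hxc⟩ := hpq.exists_isPElement hG hH.piProcyclic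
    obtain ⟨hdvd, φ, hφ⟩ := key x hx hxc
    refine ⟨?_, hdvd, fun x hx hxc => ?_, ?_⟩
    · rintro rfl
      exact (Fact.out : p.Prime).one_lt.ne' (Nat.dvd_one.1 hdvd)
    · obtain ⟨-, φ, hφ⟩ := key x hx hxc
      refine ⟨⟨φ, hφ⟩, Set.Subset.antisymm ?_ fun b hb => ?_⟩
      · rintro _ ⟨a, ha, rfl⟩
        have h1 := (φ ⟨a, ha⟩).2
        rwa [hφ] at h1
      · refine ⟨φ.symm ⟨b, hb⟩, (φ.symm ⟨b, hb⟩).2, ?_⟩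
        refine (hφ _).symm.trans ?_
        rw [ContinuousMulEquiv.apply_symm_apply]
    -- A central `a` has `[x,a] = 1` for the `x` supplied by the edge, and `a ↦ [x,a]` is injective.
    · refine (Subgroup.eq_bot_iff_forall _).2 fun a ha => ?_
      have h1 : φ ⟨a, ha.1⟩ = 1 := Subtype.ext (by
        rw [hφ, ← hconj, hcentral x _ ha.2, mul_inv_cancel])
      exact congrArg Subtype.val ((map_eq_one_iff φ φ.injective).1 h1)
  · rintro - x hx hxc
    obtain ⟨hf, hmem, hlim, hne⟩ := conj_primaryComponent hG hA q hx hxc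
    obtain ⟨s, m, hm, hpow, h1, h2, h3⟩ := exists_unit_pow_of_tendsto hhom _ hf hmem hlim hne
    refine ⟨s, m, hm, fun a ha => ?_, Set.Subset.antisymm ?_ ?_, ?_⟩
    · obtain ⟨φ, hφ, hφ'⟩ := hpow ⟨a, ha⟩
      refine ⟨⟨(primaryComponent q A).subtype.comp φ.toMonoidHom,
        continuous_subtype_val.comp φ.continuous_toFun⟩, congrArg Subtype.val hφ, ?_⟩
      exact (congrArg Subtype.val hφ').trans (hconj x ⟨a, ha⟩)
    · rintro _ ⟨a, ha, rfl⟩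
      obtain ⟨b, hb⟩ := h1 ⟨a, ha⟩
      exact ⟨b, b.2, ((hconj x ⟨a, ha⟩).symm.trans (congrArg Subtype.val hb)).symm⟩
    · rintro _ ⟨b, hb, rfl⟩
      obtain ⟨a, ha⟩ := h2 ⟨b, hb⟩
      exact ⟨a, a.2, (hconj x a).symm.trans (congrArg Subtype.val ha)⟩
    · refine Monoid.exponent_dvd_of_forall_pow_eq_one fun a => Subtype.ext ?_
      have h4 := congrArg Subtype.val (h3 ⟨a, a.2.1⟩ (hcentral x ⟨a, a.2.1⟩ a.2.2))
      simpa using h4
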